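/- Let $A$ be an abelian group and let $M$ be a partial group, i.e. a simplicial set with exactly one vertex $\ast$ whose spine maps $M_n\to M_1^{\,n}$ ($n\ge 1$) are injective, together with a simplicial map $\nu:M\to M^{\mathrm{op}}$ such that for each $x\in M_n$, $n\geq 1$, there is a simplex $(\nu(x),x)\in M_{2n}$ whose product is $1=s_0(\ast)$. For $x,y\in M_1$ that form the spine of a $2$-simplex $(x,y)$, write $x\cdot y=d_1(x,y)$. Let $NA\xrightarrow{i}E\xrightarrow{\pi}M$ be a central partial group extension, identified with the twisted product $NA\times_\beta M$ of a normalized $2$-cocycle $\beta:M_2\to A$. Thus the $n$-simplices of $E$ are the pairs $((a_1,\dots,a_n),x)\in A^n\times M_n$, the product of $1$-simplices is $(a_1,x)\cdot(a_2,y)=(a_1+a_2+\beta(x,y),\,x\cdot y)$, $\pi$ is the projection and $i$ is the inclusion of the fibre over $\ast$. Let $G$ be a group acting on $E$ by simplicial automorphisms that fix $i(NA)$ pointwise. This induces an action of $G$ on $M$ for which $\pi$ is equivariant. Put $\eta(x)=(0,x)$ for $x\in M_1$, and define $\Phi:G\times M_1\to A$ by $g\cdot\eta(g^{-1}\cdot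 x)=(\Phi_g(x),x)$. For a simplicial $G$-set $X$ let $S_G(X)_{p,q}=(EG)_p\times_G X_q$, where $(EG)_p=G^{p+1}$, $d_i(g_0,\dots,g_p)=(g_0,\dots,g_ig_{i+1},\dots,g_p)$ for $i<p$, $d_p$ omits $g_p$, degeneracies insert $1$, and $G$ acts by left multiplication on $g_0$. The Borel construction $X/\!/G$ is the diagonal of $S_G(X)$. For $p,q\ge 0$ let $d^h$ and $d^v$ be the alternating sums of the maps induced by the faces in the $p$- and in the $q$-direction on the cochains $S_G(M)_{p,q}\to A$. Regard $s:M_1\to A$ as the $(0,1)$-cochain $[(1),x]\mapsto s(x)$, $\beta$ as the $(0,2)$-cochain $[(1),x]\mapsto\beta(x)$, and $\Phi$ as the $(1,1)$-cochain $[(1,g),x]\mapsto\Phi_g(x)$. Let $\eta_G:(M/\!/G)_1\to(E/\!/G)_1$ be $[(1,g),x]\mapsto[(1,g),\eta(x)]$, and let $\beta_G:(M/\!/G)_2\to A$ be the $2$-cocycle determined, for a $2$-simplex with spine $(x,y)$, by $\beta_G(x,y)\cdot\eta_G(x\cdot y)=\eta_G(x)\cdot\eta_G(y)$ in $E/\!/G$,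 where $A=(NA)_1$ is included in $E/\!/G$ by $a\mapsto[(1,1),i(a)]$. Then the following are equivalent: \begin{enumerate} \item The class $[\beta_G]\in H^2(M/\!/G,A)$ is zero. \item There is a function $s:M_1\to A$ with $d^vs=\beta$ and $d^hs=\Phi$. \item There is a $G$-equivariant simplicial map $\lambda:M\to E$ with $\pi\circ\lambda=\mathrm{id}_M$. \end{enumerate} -/

import Mathlib

open CategoryTheory Simplicial Opposite

universe u

namespace PartialGroupExt

/-! ### Partial groups -/

/-- A partial monoid: a simplicial set with exactly one vertex, all of whose spine maps
`M_n → M_1 × ⋯ × M_1`, `n ≥ 1`, are injective. -/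
class IsPartialMonoid (M : SSet.{u}) : Prop where
  nonempty : Nonempty (M _⦋0⦌)
  subsingleton : Subsingleton (M _⦋0⦌)
  spine_injective : ∀ n : ℕ, 1 ≤ n → Function.Injective
    (fun (x : M _⦋n⦌) (i : Fin n) => M.map (SimplexCategory.mkOfSucc i).op x)

/-- The vertex of a partial monoid. -/
noncomputable def vertex (M : SSet.{u}) [IsPartialMonoid M] : M _⦋0⦌ :=
  Classical.choice IsPartialMonoid.nonempty

/-- The unit `1 = s₀(∗) ∈ M_1` of a partial monoid. -/
noncomputable def one (M : SSet.{u}) [IsPartialMonoid M] : M _⦋1⦌ := M.σ 0 (vertex M)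

/-- A partial group: a partial monoid with an inversion, that is, a simplicial map `ν : M → Mᵒᵖ`
such that for every `x ∈ M_n`, `n ≥ 1`, there is a simplex `(ν x, x) ∈ M_{2n}` with product `1`. -/
class IsPartialGroup (M : SSet.{u}) : Prop extends IsPartialMonoid M where
  exists_inversion : ∃ ν : M ⟶ M.op, ∀ n : ℕ, 1 ≤ n → ∀ x : M _⦋n⦌, ∃ y : M _⦋n + n⦌,
    M.map (SimplexCategory.subinterval 0 n (by omega)).op y = SSet.opObjEquiv (ν.app _ x) ∧
    M.map (SimplexCategory.subinterval n n le_rfl).op y = x ∧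
    M.map (SimplexCategory.diag (n + n)).op y = one M

/-- The nerve `NA` of an abelian group `A`. -/
abbrev nerveGroup (A : Type u) [AddCommGroup A] : SSet.{u} :=
  nerve (SingleObj (Multiplicative A))

/-- The element of `A` on the edge `e` of a simplex of `NA`. -/
def nerveLabel {A : Type u} [AddCommGroup A] {n : SimplexCategory}
    (b : (nerveGroup A).obj (op n)) (e : ⦋1⦌ ⟶ n) : A :=
  Multiplicative.toAdd (α := A)
    (b.map (homOfLE (e.toOrderHom.monotone (Fin.zero_le 1))))

/-! ### Simplicial cohomology in degree two -/

section Cohomology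

variable (X : SSet.{u}) (A : Type u) [AddCommGroup A]

/-- The simplicial coboundary `C^n(X, A) → C^{n+1}(X, A)`. -/
def cobd (n : ℕ) : (X _⦋n⦌ → A) →+ (X _⦋n + 1⦌ → A) where
  toFun f x := ∑ i : Fin (n + 2), (-1 : ℤ) ^ (i : ℕ) • f (X.δ i x)
  map_zero' := by ext; simp
  map_add' f g := by ext; simp [Finset.sum_add_distrib]

/-- `H²(X, A)`: two-cocycles modulo coboundaries of one-cochains. -/
abbrev H2 : Type u :=
  (cobd X A 2).ker ⧸ ((cobd X A 1).range.addSubgroupOf (cobd X A 2).ker)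

/-- The class of a two-cocycle. -/
def H2.mk (z : (cobd X A 2).ker) : H2 X A := QuotientAddGroup.mk z

end Cohomology

/-! ### Central extensions -/

section Twisted

variable {A : Type u} [AddCommGroup A] {M : SSet.{u}}

/-- A normalized two-cocycle: `β(x, 1) = 0 = β(1, x)` for `x ∈ M_1`, and
`β(y, z) + β(x, y z) = β(x, y) + β(x y, z)` for `(x, y, z) ∈ M_3`. -/
structure IsTwisting (β : M _⦋2⦌ → A) : Prop where
  degen_zero : ∀ x : M _⦋1⦌, β (M.σ 0 x) = 0
  degen_one : ∀ x : M _⦋1⦌, β (M.σ 1 x) = 0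
  cocycle : ∀ x : M _⦋3⦌, β (M.δ 0 x) + β (M.δ 2 x) = β (M.δ 3 x) + β (M.δ 1 x)

/-- An `n`-simplex of the twisted product `NA ×_β M`: an `n`-simplex of `M` together with an
element of `A` on each of its edges, multiplicative for the twisted product
`(a₁, x) ⋅ (a₂, y) = (a₁ + a₂ + β(x, y), x ⋅ y)`. The labels of the edges of the spine are
arbitrary and determine the others, see `TwistedSimplex.coords_bijective`, so that the
`n`-simplices are the elements `((a₁, …, a_n), x)` of `A^n × M_n`. -/
@[ext]
structure TwistedSimplex (β : M _⦋2⦌ → A) (n : SimplexCategory) where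
  base : M.obj (op n)
  label : (⦋1⦌ ⟶ n) → A
  label_mul : ∀ t : ⦋2⦌ ⟶ n, label (SimplexCategory.δ 1 ≫ t) =
    label (SimplexCategory.δ 2 ≫ t) + label (SimplexCategory.δ 0 ≫ t) + β (M.map t.op base)

/-- The twisted product `NA ×_β M`. -/
def twistedProduct (β : M _⦋2⦌ → A) : SSet.{u} where
  obj n := TwistedSimplex β n.unop
  map {m n} θ := ↾fun x =>
    { base := M.map θ x.base
      label := fun e => x.label (e ≫ θ.unop)
      label_mul := fun t => by
        have h := x.label_mul (t ≫ θ.unop)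
        simp only [op_comp, Quiver.Hom.op_unop, Functor.map_comp_apply] at h
        simpa only [Category.assoc] using h }
  map_id n := by
    ext x
    · simp
    · simp
  map_comp f g := by
    ext x
    · simp
    · simp

end Twisted

section Coordinates

variable {A : Type u} [AddCommGroup A] {M : SSet.{u}}

/-- The map `⦋2⦌ ⟶ n` with values `i ≤ j ≤ k`. -/
abbrev tri {n : SimplexCategory} (i j k : Fin (n.len + 1)) (h₁ : i ≤ j) (h₂ : j ≤ k) :
    ⦋2⦌ ⟶ n := SimplexCategory.mkOfLeComp i j k h₁ h₂

/-- The value of `β` on the triangle of `σ` with vertices `i ≤ j ≤ k`. -/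
def triVal (β : M _⦋2⦌ → A) {n : SimplexCategory} (σ : M.obj (op n))
    (i j k : Fin (n.len + 1)) : A :=
  if h : i ≤ j ∧ j ≤ k then β (M.map (tri i j k h.1 h.2).op σ) else 0

lemma triVal_eq (β : M _⦋2⦌ → A) {n : SimplexCategory} (σ : M.obj (op n)) (t : ⦋2⦌ ⟶ n) :
    triVal β σ (t.toOrderHom 0) (t.toOrderHom 1) (t.toOrderHom 2) = β (M.map t.op σ) := by
  have h : t.toOrderHom 0 ≤ t.toOrderHom 1 ∧ t.toOrderHom 1 ≤ t.toOrderHom 2 :=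
    ⟨t.toOrderHom.monotone (by decide), t.toOrderHom.monotone (by decide)⟩
  have e : tri _ _ _ h.1 h.2 = t := by
    ext i
    fin_cases i <;> rfl
  rw [triVal, dif_pos h, e]

lemma triVal_degen {β : M _⦋2⦌ → A} (hβ : IsTwisting β) {n : SimplexCategory} (σ : M.obj (op n))
    (i j : Fin (n.len + 1)) : triVal β σ i j j = 0 := by
  unfold triVal
  split_ifs with h
  · have e : tri i j j h.1 h.2 = SimplexCategory.σ 1 ≫ SimplexCategory.mkOfLe i j h.1 := by
      ext k
      fin_cases k <;> rfl
    rw [e, op_comp, Functor.map_comp_apply]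
    exact hβ.degen_one _
  · rfl

lemma triVal_degen' {β : M _⦋2⦌ → A} (hβ : IsTwisting β) {n : SimplexCategory}
    (σ : M.obj (op n)) (i j : Fin (n.len + 1)) : triVal β σ i i j = 0 := by
  unfold triVal
  split_ifs with h
  · have e : tri i i j h.1 h.2 = SimplexCategory.σ 0 ≫ SimplexCategory.mkOfLe i j h.2 := by
      ext k
      fin_cases k <;> rfl
    rw [e, op_comp, Functor.map_comp_apply]
    exact hβ.degen_zero _
  · rfl

lemma triVal_cocycle {β : M _⦋2⦌ → A} (hβ : IsTwisting β) {n : SimplexCategory}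
    (σ : M.obj (op n)) (i j k l : Fin (n.len + 1)) (h₁ : i ≤ j) (h₂ : j ≤ k) (h₃ : k ≤ l) :
    triVal β σ j k l + triVal β σ i j l = triVal β σ i j k + triVal β σ i k l := by
  let T : ⦋3⦌ ⟶ n := SimplexCategory.mkHom
    { toFun := ![i, j, k, l]
      monotone' := by
        intro a b hab
        have h13 := h₁.trans h₂
        have h24 := h₂.trans h₃
        have h14 := h₁.trans h24
        fin_cases a <;> fin_cases b <;>
          first
            | (exact le_rfl)
            | assumption
            | (exact absurd hab (by decide)) }
  have key := hβ.cocycle (M.map T.op σ)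
  have face : ∀ (q : Fin 4), β (M.δ q (M.map T.op σ)) =
      triVal β σ ((SimplexCategory.δ q ≫ T).toOrderHom 0)
        ((SimplexCategory.δ q ≫ T).toOrderHom 1) ((SimplexCategory.δ q ≫ T).toOrderHom 2) := by
    intro q
    rw [triVal_eq, op_comp, Functor.map_comp_apply]
    rfl
  rw [face, face, face, face] at key
  exact key

/-- The label of the edge from `i` to `j` determined by the labels of the spine. -/
def edgeSum (β : M _⦋2⦌ → A) {n : SimplexCategory} (a : Fin n.len → A) (σ : M.obj (op n))
    (i j : Fin (n.len + 1)) : A :=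
  ∑ l : Fin n.len with i ≤ l.castSucc ∧ l.castSucc < j, (a l + triVal β σ i l.castSucc l.succ)

lemma edgeSum_self (β : M _⦋2⦌ → A) {n : SimplexCategory} (a : Fin n.len → A)
    (σ : M.obj (op n)) (i : Fin (n.len + 1)) : edgeSum β a σ i i = 0 := by
  unfold edgeSum
  rw [Finset.filter_false_of_mem, Finset.sum_empty]
  rintro l - ⟨h, h'⟩
  exact absurd h' (not_lt.2 h)

lemma edgeSum_succ (β : M _⦋2⦌ → A) {n : SimplexCategory} (a : Fin n.len → A)
    (σ : M.obj (op n)) (i : Fin (n.len + 1)) (l : Fin n.len) (h : i ≤ l.castSucc) :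
    edgeSum β a σ i l.succ =
      edgeSum β a σ i l.castSucc + (a l + triVal β σ i l.castSucc l.succ) := by
  unfold edgeSum
  have : (Finset.univ.filter fun m : Fin n.len => i ≤ m.castSucc ∧ m.castSucc < l.succ) =
      insert l (Finset.univ.filter fun m : Fin n.len => i ≤ m.castSucc ∧
        m.castSucc < l.castSucc) := by
    ext m
    simp only [Finset.mem_filter, Finset.mem_univ, true_and, Finset.mem_insert,
      Fin.lt_def, Fin.le_def, Fin.ext_iff, Fin.val_castSucc, Fin.val_succ] at h ⊢
    omega
  rw [this, Finset.sum_insert (by simp), add_comm]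

lemma edgeSum_mul {β : M _⦋2⦌ → A} (hβ : IsTwisting β) {n : SimplexCategory}
    (a : Fin n.len → A) (σ : M.obj (op n)) (i j k : Fin (n.len + 1)) (h₁ : i ≤ j) (h₂ : j ≤ k) :
    edgeSum β a σ i k = edgeSum β a σ i j + edgeSum β a σ j k + triVal β σ i j k := by
  induction k using Fin.induction with
  | zero =>
    obtain rfl : j = 0 := le_antisymm h₂ (Fin.zero_le _)
    rw [edgeSum_self, triVal_degen hβ, add_zero, add_zero]
  | succ l ih =>
    rcases h₂.eq_or_lt with rfl | h₂
    · rw [edgeSum_self, triVal_degen hβ, add_zero, add_zero]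
    · have hj : j ≤ l.castSucc := by
        simp only [Fin.lt_def, Fin.le_def, Fin.val_castSucc, Fin.val_succ] at h₂ ⊢
        omega
      have hl : l.castSucc ≤ l.succ := Fin.castSucc_le_succ l
      rw [edgeSum_succ β a σ i l (h₁.trans hj), edgeSum_succ β a σ j l hj, ih hj]
      have := triVal_cocycle hβ σ i j l.castSucc l.succ h₁ hj hl
      rw [← sub_eq_zero] at this ⊢
      rw [← neg_eq_zero, ← this]
      abel

/-- The simplex of `NA ×_β M` with coordinates `((a₁, …, a_n), σ)`. -/
def TwistedSimplex.ofCoords {β : M _⦋2⦌ → A} (hβ : IsTwisting β) {n : SimplexCategory}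
    (a : Fin n.len → A) (σ : M.obj (op n)) : TwistedSimplex β n where
  base := σ
  label e := edgeSum β a σ (e.toOrderHom 0) (e.toOrderHom 1)
  label_mul t := by
    rw [← triVal_eq β σ t]
    exact edgeSum_mul hβ a σ _ _ _ (t.toOrderHom.monotone (by decide))
      (t.toOrderHom.monotone (by decide))

/-- The coordinates `((a₁, …, a_n), σ) ∈ A^n × M_n` of a simplex of `NA ×_β M`. -/
def TwistedSimplex.coords {β : M _⦋2⦌ → A} {n : SimplexCategory} (x : TwistedSimplex β n) :
    (Fin n.len → A) × M.obj (op n) :=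
  (fun i => x.label (SimplexCategory.mkOfSucc (n := n.len) i), x.base)

lemma TwistedSimplex.coords_ofCoords {β : M _⦋2⦌ → A} (hβ : IsTwisting β) {n : SimplexCategory}
    (a : Fin n.len → A) (σ : M.obj (op n)) : (ofCoords hβ a σ).coords = (a, σ) := by
  ext i
  · change edgeSum β a σ i.castSucc i.succ = a i
    rw [edgeSum_succ β a σ _ i le_rfl, edgeSum_self, triVal_degen' hβ, zero_add, add_zero]
  · rfl

lemma TwistedSimplex.label_mkOfLe_self {β : M _⦋2⦌ → A} (hβ : IsTwisting β) {n : SimplexCategory}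
    (x : TwistedSimplex β n) (i : Fin (n.len + 1)) :
    x.label (SimplexCategory.mkOfLe (n := n.len) i i le_rfl) = 0 := by
  have h := x.label_mul (tri i i i le_rfl le_rfl)
  have e : ∀ q : Fin 3, SimplexCategory.δ q ≫ tri (n := n) i i i le_rfl le_rfl =
      SimplexCategory.mkOfLe (n := n.len) i i le_rfl := by
    intro q
    ext k
    fin_cases q <;> fin_cases k <;> rfl
  rw [e, e, e, ← triVal_eq β x.base (tri i i i le_rfl le_rfl)] at h
  have h0 : triVal β x.base i i i = 0 := triVal_degen hβ x.base i i
  have h1 : x.label (SimplexCategory.mkOfLe (n := n.len) i i le_rfl) =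
      x.label (SimplexCategory.mkOfLe (n := n.len) i i le_rfl) +
      x.label (SimplexCategory.mkOfLe (n := n.len) i i le_rfl) + triVal β x.base i i i := h
  rw [h0, add_zero] at h1
  simpa using h1

lemma TwistedSimplex.coords_injective {β : M _⦋2⦌ → A} (hβ : IsTwisting β)
    {n : SimplexCategory} : Function.Injective (coords (β := β) (n := n)) := by
  intro x y hxy
  have hb : x.base = y.base := congrArg Prod.snd hxy
  have hs : ∀ i : Fin n.len, x.label (SimplexCategory.mkOfSucc (n := n.len) i) =
      y.label (SimplexCategory.mkOfSucc (n := n.len) i) := fun i =>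
    congrFun (congrArg Prod.fst hxy) i
  have hle : ∀ (j i : Fin (n.len + 1)) (h : i ≤ j),
      x.label (SimplexCategory.mkOfLe (n := n.len) i j h) =
      y.label (SimplexCategory.mkOfLe (n := n.len) i j h) := by
    intro j
    induction j using Fin.induction with
    | zero =>
      intro i h
      obtain rfl : i = 0 := le_antisymm h (Fin.zero_le _)
      rw [label_mkOfLe_self hβ, label_mkOfLe_self hβ]
    | succ l ih =>
      intro i h
      rcases h.eq_or_lt with rfl | h'
      · rw [label_mkOfLe_self hβ, label_mkOfLe_self hβ]
      · have hj : i ≤ l.castSucc := by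
          simp only [Fin.lt_def, Fin.le_def, Fin.val_castSucc, Fin.val_succ] at h' ⊢
          omega
        have hl : l.castSucc ≤ l.succ := Fin.castSucc_le_succ l
        have e1 : SimplexCategory.δ 1 ≫ tri (n := n) i l.castSucc l.succ hj hl =
            SimplexCategory.mkOfLe (n := n.len) i l.succ h := by
          ext k; fin_cases k <;> rfl
        have e2 : SimplexCategory.δ 2 ≫ tri (n := n) i l.castSucc l.succ hj hl =
            SimplexCategory.mkOfLe (n := n.len) i l.castSucc hj := by
          ext k; fin_cases k <;> rfl
        have e0 : SimplexCategory.δ 0 ≫ tri (n := n) i l.castSucc l.succ hj hl =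
            SimplexCategory.mkOfSucc (n := n.len) l := by
          ext k; fin_cases k <;> rfl
        have hx := x.label_mul (tri i l.castSucc l.succ hj hl)
        have hy := y.label_mul (tri i l.castSucc l.succ hj hl)
        rw [e1, e2, e0] at hx hy
        rw [hx, hy, ih i hj, hs, hb]
  apply TwistedSimplex.ext hb
  funext e
  have e' : e = SimplexCategory.mkOfLe (n := n.len) (e.toOrderHom 0) (e.toOrderHom 1)
      (e.toOrderHom.monotone (Fin.zero_le 1)) := by
    ext k; fin_cases k <;> rfl
  rw [e']
  exact hle _ _ _

/-- The `n`-simplices of `NA ×_β M` are the elements of `A^n × M_n`. -/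
theorem TwistedSimplex.coords_bijective {β : M _⦋2⦌ → A} (hβ : IsTwisting β)
    (n : SimplexCategory) : Function.Bijective (coords (β := β) (n := n)) :=
  ⟨coords_injective hβ, fun p => ⟨ofCoords hβ p.1 p.2, coords_ofCoords hβ p.1 p.2⟩⟩

end Coordinates

section Extension

variable {A : Type u} [AddCommGroup A] {M : SSet.{u}}

lemma toZero_eq {n : SimplexCategory} (f g : n ⟶ ⦋0⦌) : f = g := by
  ext i
  exact congrArg Fin.val (Subsingleton.elim (α := Fin 1) (f.toOrderHom i) (g.toOrderHom i))

/-- The projection `NA ×_β M → M`. -/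
def twistedProduct.proj (β : M _⦋2⦌ → A) : twistedProduct β ⟶ M where
  app _ := ↾fun x => TwistedSimplex.base x
  naturality _ _ _ := rfl

/-- The inclusion `NA → NA ×_β M` of the fibre over the vertex of `M`. -/
noncomputable def twistedProduct.incl [IsPartialMonoid M] {β : M _⦋2⦌ → A} (hβ : IsTwisting β) :
    nerveGroup A ⟶ twistedProduct β where
  app n := ↾fun b =>
    { base := (SSet.const (X := nerveGroup A) (vertex M)).app n b
      label := fun e => nerveLabel b e
      label_mul := fun t => by
        have h : M.map t.op ((SSet.const (X := nerveGroup A) (vertex M)).app n b) =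
            M.σ 0 (one M) := by
          change M.map _ (M.map _ _) = M.map _ (M.map _ _)
          rw [← Functor.map_comp_apply, ← Functor.map_comp_apply]
          exact congrArg (fun f : ⦋2⦌ ⟶ ⦋0⦌ => M.map f.op (vertex M)) (toZero_eq _ _)
        rw [h, hβ.degen_zero, add_zero]
        have key : b.map (homOfLE (t.toOrderHom.monotone (show (0 : Fin 3) ≤ 2 by decide))) =
            b.map (homOfLE (t.toOrderHom.monotone (show (0 : Fin 3) ≤ 1 by decide))) ≫
            b.map (homOfLE (t.toOrderHom.monotone (show (1 : Fin 3) ≤ 2 by decide))) := by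
          exact (Functor.map_comp (C := Fin (n.unop.len + 1)) b _ _)
        exact (congrArg (Multiplicative.toAdd (α := A)) key).trans (add_comm (G := A) _ _) }
  naturality m n θ := by
    ext b
    apply TwistedSimplex.ext
    · change M.map _ _ = M.map _ (M.map _ _)
      rw [← Functor.map_comp_apply]
      rfl
    · rfl

/-- A central extension `NA → E → M` of a partial group `M` by an abelian group `A`: an extension
identified with a twisted product `NA ×_β M` for a normalized two-cocycle `β`. -/
structure CentralExtension (A : Type u) [AddCommGroup A] (M : SSet.{u}) [IsPartialGroup M] where
  /-- the total space -/
  E : SSet.{u}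
  /-- the inclusion of the fibre -/
  i : nerveGroup A ⟶ E
  /-- the projection -/
  π : E ⟶ M
  /-- the twisting cocycle -/
  β : M _⦋2⦌ → A
  isTwisting : IsTwisting β
  /-- the identification with the twisted product -/
  iso : E ≅ twistedProduct β
  i_comp_iso : i ≫ iso.hom = twistedProduct.incl isTwisting
  iso_comp_proj : iso.hom ≫ twistedProduct.proj β = π

namespace CentralExtension

variable [IsPartialGroup M] (X : CentralExtension A M)

/-- The simplex of `E` over `m` with coordinates `(a₁, …, a_n)`. -/
def simplex {n : SimplexCategoryᵒᵖ} (a : Fin n.unop.len → A) (m : M.obj n) : X.E.obj n :=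
  X.iso.inv.app n (TwistedSimplex.ofCoords X.isTwisting a m)

/-- The simplex `η(x) = (0, x)` of `E` over `x`. On `1`-simplices this is the pseudo-section. -/
def η {n : SimplexCategoryᵒᵖ} (m : M.obj n) : X.E.obj n := X.simplex (fun _ => 0) m

/-- The coordinate `a` of a `1`-simplex `(a, m)` of `E`. -/
def coord (x : X.E _⦋1⦌) : A := TwistedSimplex.label (X.iso.hom.app _ x) (𝟙 _)

lemma base_hom {n : SimplexCategoryᵒᵖ} (x : X.E.obj n) :
    TwistedSimplex.base (X.iso.hom.app n x) = X.π.app n x := by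
  rw [← X.iso_comp_proj]
  rfl

lemma hom_inv {n : SimplexCategoryᵒᵖ} (y : (twistedProduct X.β).obj n) :
    X.iso.hom.app n (X.iso.inv.app n y) = y := by
  rw [← types_comp_apply, ← NatTrans.comp_app, X.iso.inv_hom_id]
  rfl

lemma inv_hom {n : SimplexCategoryᵒᵖ} (y : X.E.obj n) :
    X.iso.inv.app n (X.iso.hom.app n y) = y := by
  rw [← types_comp_apply, ← NatTrans.comp_app, X.iso.hom_inv_id]
  rfl

lemma coord_map {n : SimplexCategory} (x : X.E.obj (op n)) (e : ⦋1⦌ ⟶ n) :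
    X.coord (X.E.map e.op x) = TwistedSimplex.label (X.iso.hom.app _ x) e := by
  unfold coord
  rw [NatTrans.naturality_apply]
  change TwistedSimplex.label _ (𝟙 _ ≫ e) = _
  rw [Category.id_comp]

lemma hom_simplex {n : SimplexCategoryᵒᵖ} (a : Fin n.unop.len → A) (m : M.obj n) :
    X.iso.hom.app n (X.simplex a m) = TwistedSimplex.ofCoords X.isTwisting a m :=
  X.hom_inv _

lemma π_simplex {n : SimplexCategoryᵒᵖ} (a : Fin n.unop.len → A) (m : M.obj n) :
    X.π.app n (X.simplex a m) = m := by
  rw [← base_hom, hom_simplex]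
  rfl

lemma coord_spine_simplex {n : ℕ} (a : Fin n → A) (m : M _⦋n⦌) (i : Fin n) :
    X.coord (X.E.map (SimplexCategory.mkOfSucc i).op (X.simplex (n := op ⦋n⦌) a m)) = a i := by
  rw [coord_map, hom_simplex]
  exact congrFun (congrArg Prod.fst
    (TwistedSimplex.coords_ofCoords X.isTwisting (n := ⦋n⦌) a m)) i

lemma ext_coord {n : ℕ} {x y : X.E _⦋n⦌} (hπ : X.π.app _ x = X.π.app _ y)
    (hc : ∀ i : Fin n, X.coord (X.E.map (SimplexCategory.mkOfSucc i).op x) =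
      X.coord (X.E.map (SimplexCategory.mkOfSucc i).op y)) : x = y := by
  rw [← X.inv_hom x, ← X.inv_hom y]
  congr 1
  apply TwistedSimplex.coords_injective X.isTwisting
  refine Prod.ext ?_ ?_
  · funext i
    have := hc i
    rw [coord_map, coord_map] at this
    exact this
  · change TwistedSimplex.base _ = TwistedSimplex.base _
    rw [base_hom, base_hom, hπ]

lemma mkOfSucc_one : SimplexCategory.mkOfSucc (0 : Fin 1) = 𝟙 ⦋1⦌ := by
  ext k; fin_cases k <;> rfl

lemma mkOfSucc_two_zero : SimplexCategory.mkOfSucc (0 : Fin 2) = SimplexCategory.δ 2 := by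
  ext k; fin_cases k <;> rfl

lemma mkOfSucc_two_one : SimplexCategory.mkOfSucc (1 : Fin 2) = SimplexCategory.δ 0 := by
  ext k; fin_cases k <;> rfl

lemma coord_simplex (a : Fin 1 → A) (m : M _⦋1⦌) : X.coord (X.simplex (n := op ⦋1⦌) a m) = a 0 := by
  have := X.coord_spine_simplex a m 0
  rwa [mkOfSucc_one, op_id, Functor.map_id_apply] at this

lemma coord_η (m : M _⦋1⦌) : X.coord (X.η m) = 0 := X.coord_simplex _ m

lemma π_η {n : SimplexCategoryᵒᵖ} (m : M.obj n) : X.π.app n (X.η m) = m := X.π_simplex _ m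

lemma ext_one {x y : X.E _⦋1⦌} (hπ : X.π.app _ x = X.π.app _ y) (hc : X.coord x = X.coord y) :
    x = y := by
  apply X.ext_coord hπ
  intro i
  obtain rfl := Subsingleton.elim i 0
  rwa [mkOfSucc_one, op_id, Functor.map_id_apply, Functor.map_id_apply]

lemma ext_two {x y : X.E _⦋2⦌} (hπ : X.π.app _ x = X.π.app _ y)
    (h₂ : X.coord (X.E.δ 2 x) = X.coord (X.E.δ 2 y))
    (h₀ : X.coord (X.E.δ 0 x) = X.coord (X.E.δ 0 y)) : x = y := by
  apply X.ext_coord hπ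
  intro i
  fin_cases i
  · change X.coord (X.E.map (SimplexCategory.mkOfSucc (0 : Fin 2)).op x) =
      X.coord (X.E.map (SimplexCategory.mkOfSucc (0 : Fin 2)).op y)
    rw [mkOfSucc_two_zero]; exact h₂
  · change X.coord (X.E.map (SimplexCategory.mkOfSucc (1 : Fin 2)).op x) =
      X.coord (X.E.map (SimplexCategory.mkOfSucc (1 : Fin 2)).op y)
    rw [mkOfSucc_two_one]; exact h₀

lemma exists_two (a₂ a₀ : A) (m : M _⦋2⦌) : ∃ w : X.E _⦋2⦌, X.π.app _ w = m ∧
    X.coord (X.E.δ 2 w) = a₂ ∧ X.coord (X.E.δ 0 w) = a₀ := by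
  refine ⟨X.simplex (n := op ⦋2⦌) ![a₂, a₀] m, X.π_simplex _ _, ?_, ?_⟩
  · have := X.coord_spine_simplex ![a₂, a₀] m 0
    rwa [mkOfSucc_two_zero] at this
  · have := X.coord_spine_simplex ![a₂, a₀] m 1
    rwa [mkOfSucc_two_one] at this

/-- The twisted multiplication rule. -/
lemma coord_mul (w : X.E _⦋2⦌) : X.coord (X.E.δ 1 w) =
    X.coord (X.E.δ 2 w) + X.coord (X.E.δ 0 w) + X.β (X.π.app _ w) := by
  have h := TwistedSimplex.label_mul (X.iso.hom.app _ w) (𝟙 ⦋2⦌)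
  rw [op_id, Functor.map_id_apply, base_hom] at h
  simp only [Category.comp_id] at h
  have e : ∀ q : Fin 3, X.coord (X.E.δ q w) =
      TwistedSimplex.label (X.iso.hom.app _ w) (SimplexCategory.δ q) :=
    fun q => X.coord_map w (SimplexCategory.δ q)
  rw [e, e, e]
  exact h

lemma hom_i {n : SimplexCategoryᵒᵖ} (b : (nerveGroup A).obj n) :
    X.iso.hom.app n (X.i.app n b) = (twistedProduct.incl X.isTwisting).app n b := by
  rw [← X.i_comp_iso]
  rfl

lemma π_i (b : (nerveGroup A) _⦋1⦌) : X.π.app _ (X.i.app _ b) = one M := by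
  rw [← base_hom, hom_i]
  exact congrArg (fun f : ⦋1⦌ ⟶ ⦋0⦌ => M.map f.op (vertex M)) (toZero_eq _ _)

/-- The `1`-simplex of `NA` given by `a ∈ A`. -/
def nerveEdge (a : A) : (nerveGroup A) _⦋1⦌ :=
  ComposableArrows.mk₁ (C := SingleObj (Multiplicative A))
    (X₀ := SingleObj.star _) (X₁ := SingleObj.star _) (Multiplicative.ofAdd a)

lemma coord_i (a : A) : X.coord (X.i.app _ (nerveEdge a)) = a := by
  unfold coord
  rw [hom_i]
  rfl

end CentralExtension

end Extension

section SimplicialGSets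

variable {G : Type u} [Group G] {X : SSet.{u}} (ρ : G →* Aut X)

/-- The action of `g` on the simplices of a simplicial `G`-set. -/
def act (g : G) {n : SimplexCategoryᵒᵖ} (x : X.obj n) : X.obj n := (ρ g).hom.app n x

lemma act_one {n : SimplexCategoryᵒᵖ} (x : X.obj n) : act ρ 1 x = x := by
  unfold act
  rw [map_one]
  rfl

lemma act_mul (g h : G) {n : SimplexCategoryᵒᵖ} (x : X.obj n) :
    act ρ (g * h) x = act ρ g (act ρ h x) := by
  unfold act
  rw [map_mul]
  rfl

lemma act_map (g : G) {m n : SimplexCategoryᵒᵖ} (θ : m ⟶ n) (x : X.obj m) :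
    act ρ g (X.map θ x) = X.map θ (act ρ g x) :=
  NatTrans.naturality_apply _ _ _

lemma act_inv_act (g : G) {n : SimplexCategoryᵒᵖ} (x : X.obj n) :
    act ρ g⁻¹ (act ρ g x) = x := by
  rw [← act_mul, inv_mul_cancel, act_one]

lemma act_act_inv (g : G) {n : SimplexCategoryᵒᵖ} (x : X.obj n) :
    act ρ g (act ρ g⁻¹ x) = x := by
  rw [← act_mul, mul_inv_cancel, act_one]

/-- The orbit relation of `G` on `(EG)_p × X_q`. Here `(EG)_p = G^{p+1}` with homogeneous
coordinates: `(h₀, …, h_p)` stands for the simplex `(g₀, …, g_p)` with `h_i = g₀ ⋯ g_i`. So `G`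
acts by left multiplication on all `h_i`, and simplicial operators reindex the `h_i`. -/
def borelSetoid (p q : SimplexCategory) :
    Setoid ((Fin (p.len + 1) → G) × X.obj (op q)) where
  r a b := ∃ g : G, (fun i => g * a.1 i) = b.1 ∧ act ρ g a.2 = b.2
  iseqv :=
    { refl := fun a => ⟨1, by simp, act_one ρ _⟩
      symm := by
        rintro ⟨a, x⟩ ⟨b, y⟩ ⟨g, rfl, rfl⟩
        exact ⟨g⁻¹, by simp, act_inv_act ρ _ _⟩
      trans := by
        rintro ⟨a, x⟩ ⟨b, y⟩ ⟨c, z⟩ ⟨g, rfl, rfl⟩ ⟨h, rfl, rfl⟩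
        exact ⟨h * g, by simp [mul_assoc], act_mul ρ _ _ _⟩ }

/-- `(EG)_p ×_G X_q`. -/
def BorelSimplex (p q : SimplexCategory) : Type u := Quotient (borelSetoid ρ p q)

/-- The class `[(h₀, …, h_p), x]`. -/
def BorelSimplex.mk {p q : SimplexCategory} (h : Fin (p.len + 1) → G) (x : X.obj (op q)) :
    BorelSimplex ρ p q := Quotient.mk _ (h, x)

variable {ρ} in
lemma BorelSimplex.mk_eq {p q : SimplexCategory} {h h' : Fin (p.len + 1) → G}
    {x x' : X.obj (op q)} : mk ρ h x = mk ρ h' x' ↔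
      ∃ g : G, (fun i => g * h i) = h' ∧ act ρ g x = x' :=
  Quotient.eq (r := borelSetoid ρ p q)

lemma BorelSimplex.mk_smul {p q : SimplexCategory} (g : G) (h : Fin (p.len + 1) → G)
    (x : X.obj (op q)) : mk ρ (fun i => g * h i) (act ρ g x) = mk ρ h x :=
  (mk_eq.2 ⟨g, rfl, rfl⟩).symm

/-- The map induced by a pair of simplicial operators. -/
def BorelSimplex.map {p q p' q' : SimplexCategory} (θ : p' ⟶ p) (ψ : q' ⟶ q) :
    BorelSimplex ρ p q → BorelSimplex ρ p' q' :=
  Quotient.lift (fun a => mk ρ (fun i => a.1 (θ.toOrderHom i)) (X.map ψ.op a.2)) (by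
    rintro ⟨a, x⟩ ⟨b, y⟩ ⟨g, rfl, rfl⟩
    exact mk_eq.2 ⟨g, rfl, act_map ρ g _ _⟩)

/-- The bisimplicial set `S_G(X)_{p,q} = (EG)_p ×_G X_q`. -/
def borelBisimplicial : SimplexCategoryᵒᵖ × SimplexCategoryᵒᵖ ⥤ Type u where
  obj n := BorelSimplex ρ n.1.unop n.2.unop
  map f := ↾(BorelSimplex.map ρ f.1.unop f.2.unop)
  map_id n := by
    ext x
    induction x using Quotient.inductionOn with | _ a =>
    exact congrArg (BorelSimplex.mk ρ a.1) (Functor.map_id_apply X _ _)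
  map_comp f g := by
    ext x
    induction x using Quotient.inductionOn with | _ a =>
    exact congrArg (BorelSimplex.mk ρ _) (Functor.map_comp_apply X _ _ _)

/-- The Borel construction `X // G`, the diagonal of `S_G(X)`. -/
def borel : SSet.{u} := Functor.diag SimplexCategoryᵒᵖ ⋙ borelBisimplicial ρ

lemma borel_δ {n : ℕ} (i : Fin (n + 2)) (h : Fin (n + 1 + 1) → G) (x : X _⦋n + 1⦌) :
    (borel ρ).δ i (BorelSimplex.mk ρ (p := ⦋n + 1⦌) (q := ⦋n + 1⦌) h x) =
      BorelSimplex.mk ρ (p := ⦋n⦌) (q := ⦋n⦌) (fun j => h (i.succAbove j)) (X.δ i x) :=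
  rfl

/-- The inclusion `X → X // G`, `x ↦ [(1, …, 1), x]`. -/
def borelIncl : X ⟶ borel ρ where
  app n := ↾fun x => BorelSimplex.mk ρ (p := n.unop) (q := n.unop) (fun _ => 1) x
  naturality _ _ _ := rfl

/-! ### The double complex of the Borel construction -/

variable (A : Type u) [AddCommGroup A]

/-- The horizontal coboundary of `C^*(S_G(X), A)`. -/
def dh (p q : ℕ) (f : BorelSimplex ρ ⦋p⦌ ⦋q⦌ → A) : BorelSimplex ρ ⦋p + 1⦌ ⦋q⦌ → A :=
  fun x => ∑ i : Fin (p + 2), (-1 : ℤ) ^ (i : ℕ) •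
    f (BorelSimplex.map ρ (SimplexCategory.δ i) (𝟙 _) x)

/-- The vertical coboundary of `C^*(S_G(X), A)`. -/
def dv (p q : ℕ) (f : BorelSimplex ρ ⦋p⦌ ⦋q⦌ → A) : BorelSimplex ρ ⦋p⦌ ⦋q + 1⦌ → A :=
  fun x => ∑ i : Fin (q + 2), (-1 : ℤ) ^ (i : ℕ) •
    f (BorelSimplex.map ρ (𝟙 _) (SimplexCategory.δ i) x)

variable {A}

/-- The cochain with value `f h x` on `[(h₀, …, h_p), x]` when `h₀ = 1`. Every class has exactly
one such representative. -/
def cochainOf {p q : SimplexCategory} (f : (Fin (p.len + 1) → G) → X.obj (op q) → A) :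
    BorelSimplex ρ p q → A :=
  Quotient.lift (fun a => f (fun i => (a.1 0)⁻¹ * a.1 i) (act ρ (a.1 0)⁻¹ a.2)) (by
    rintro ⟨a, x⟩ ⟨b, y⟩ ⟨g, rfl, rfl⟩
    simp only [mul_inv_rev, act_mul, act_inv_act, mul_assoc, inv_mul_cancel_left])

/-- A function `X_q → A` as a `(0, q)`-cochain, `[(1), x] ↦ f x`. -/
def cochainZero (q : ℕ) (f : X _⦋q⦌ → A) : BorelSimplex ρ ⦋0⦌ ⦋q⦌ → A :=
  cochainOf ρ fun _ x => f x

/-- A function `G × X_q → A` as a `(1, q)`-cochain, `[(1, g), x] ↦ f g x`. -/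
def cochainOne (q : ℕ) (f : G → X _⦋q⦌ → A) : BorelSimplex ρ ⦋1⦌ ⦋q⦌ → A :=
  cochainOf ρ fun h x => f (h 1) x

end SimplicialGSets

/-! ### Group actions on central extensions -/

section PartialMonoid

variable {M : SSet.{u}}

lemma eq_of_two [IsPartialMonoid M] {x y : M _⦋2⦌} (h₂ : M.δ 2 x = M.δ 2 y) (h₀ : M.δ 0 x = M.δ 0 y) : x = y := by
  apply IsPartialMonoid.spine_injective 2 (by decide)
  funext i
  fin_cases i
  · change M.map (SimplexCategory.mkOfSucc (0 : Fin 2)).op x =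
      M.map (SimplexCategory.mkOfSucc (0 : Fin 2)).op y
    rw [CentralExtension.mkOfSucc_two_zero]; exact h₂
  · change M.map (SimplexCategory.mkOfSucc (1 : Fin 2)).op x =
      M.map (SimplexCategory.mkOfSucc (1 : Fin 2)).op y
    rw [CentralExtension.mkOfSucc_two_one]; exact h₀

lemma σ_zero_vertex [IsPartialMonoid M] (v : M _⦋0⦌) : M.σ 0 v = one M := by
  have := IsPartialMonoid.subsingleton (M := M)
  exact congrArg (M.σ 0) (Subsingleton.elim v (vertex M))

lemma δ_two_σ_zero [IsPartialMonoid M] (x : M _⦋1⦌) : M.δ 2 (M.σ 0 x) = one M := by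
  rw [← σ_zero_vertex (M.δ 1 x)]
  exact types_congr_hom (SimplicialObject.δ_comp_σ_of_gt' M
    (i := (2 : Fin 3)) (j := (0 : Fin 2)) (by decide)) x

lemma δ_zero_σ_zero (x : M _⦋1⦌) : M.δ 0 (M.σ 0 x) = x :=
  types_congr_hom (SimplicialObject.δ_comp_σ_self M (i := (0 : Fin 2))) x

lemma δ_one_σ_zero (x : M _⦋1⦌) : M.δ 1 (M.σ 0 x) = x :=
  types_congr_hom (SimplicialObject.δ_comp_σ_succ M (i := (0 : Fin 2))) x

lemma eq_σ_zero [IsPartialMonoid M] {x : M _⦋2⦌} (h : M.δ 2 x = one M) : x = M.σ 0 (M.δ 0 x) :=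
  eq_of_two (by rw [h, δ_two_σ_zero]) (by rw [δ_zero_σ_zero])

end PartialMonoid

namespace CentralExtension

variable {A : Type u} [AddCommGroup A] {M : SSet.{u}} [IsPartialGroup M]
  (X : CentralExtension A M) {G : Type u} [Group G] (φ : G →* Aut X.E)

lemma π_map {m n : SimplexCategoryᵒᵖ} (θ : m ⟶ n) (x : X.E.obj m) :
    X.π.app n (X.E.map θ x) = M.map θ (X.π.app m x) := NatTrans.naturality_apply _ _ _

lemma π_δ {n : ℕ} (i : Fin (n + 2)) (x : X.E _⦋n + 1⦌) :
    X.π.app _ (X.E.δ i x) = M.δ i (X.π.app _ x) := X.π_map _ x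

lemma eq_i {x : X.E _⦋1⦌} (h : X.π.app _ x = one M) : x = X.i.app _ (nerveEdge (X.coord x)) :=
  X.ext_one (by rw [h, π_i]) (by rw [coord_i])

lemma act_δ {Y : SSet.{u}} (ρ : G →* Aut Y) (g : G) {n : ℕ} (i : Fin (n + 2))
    (x : Y _⦋n + 1⦌) : act ρ g (Y.δ i x) = Y.δ i (act ρ g x) := act_map ρ g _ x

/-- The action fixes the image of `NA`. -/
def Fixes : Prop := ∀ g : G, X.i ≫ (φ g).hom = X.i

variable {X φ}

lemma act_i (hφ : X.Fixes φ) (g : G) {n : SimplexCategoryᵒᵖ} (b : (nerveGroup A).obj n) :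
    act φ g (X.i.app n b) = X.i.app n b :=
  types_congr_hom (congrArg (fun f : nerveGroup A ⟶ X.E => f.app n) (hφ g)) b

lemma act_one_aux (hφ : X.Fixes φ) (g : G) {x y : X.E _⦋1⦌} (h : X.π.app _ x = X.π.app _ y) :
    X.π.app _ (act φ g y) = X.π.app _ (act φ g x) ∧
    X.coord (act φ g y) = X.coord y - X.coord x + X.coord (act φ g x) := by
  obtain ⟨w, hw, h₂, h₀⟩ := X.exists_two (X.coord y - X.coord x) (X.coord x)
    (M.σ 0 (X.π.app _ x))
  have e₂ : X.E.δ 2 w = X.i.app _ (nerveEdge (X.coord y - X.coord x)) := by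
    rw [X.eq_i (x := X.E.δ 2 w) (by rw [π_δ, hw, δ_two_σ_zero]), h₂]
  have e₀ : X.E.δ 0 w = x := X.ext_one (by rw [π_δ, hw, δ_zero_σ_zero]) h₀
  have e₁ : X.E.δ 1 w = y := by
    refine X.ext_one (by rw [π_δ, hw, δ_one_σ_zero, h]) ?_
    rw [coord_mul, h₂, h₀, hw, X.isTwisting.degen_zero]
    abel
  have f₂ : X.E.δ 2 (act φ g w) = X.i.app _ (nerveEdge (X.coord y - X.coord x)) := by
    rw [← act_δ, e₂, act_i hφ]
  have f₀ : X.E.δ 0 (act φ g w) = act φ g x := by rw [← act_δ, e₀]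
  have f₁ : X.E.δ 1 (act φ g w) = act φ g y := by rw [← act_δ, e₁]
  have hb : X.π.app _ (act φ g w) = M.σ 0 (X.π.app _ (act φ g x)) := by
    rw [eq_σ_zero (x := X.π.app _ (act φ g w)) (by rw [← π_δ, f₂, π_i]), ← π_δ, f₀]
  constructor
  · rw [← f₁, π_δ, hb, δ_one_σ_zero]
  · rw [← f₁, coord_mul, f₂, f₀, coord_i, hb, X.isTwisting.degen_zero, add_zero]

lemma π_act_eq (hφ : X.Fixes φ) (g : G) {n : SimplexCategoryᵒᵖ} {x y : X.E.obj n}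
    (h : X.π.app n x = X.π.app n y) : X.π.app n (act φ g x) = X.π.app n (act φ g y) := by
  obtain ⟨n⟩ := n
  induction n using SimplexCategory.rec with | _ n =>
  rcases Nat.eq_zero_or_pos n with rfl | hn
  · have := IsPartialMonoid.subsingleton (M := M)
    exact Subsingleton.elim (α := M _⦋0⦌) _ _
  · apply IsPartialMonoid.spine_injective (M := M) n hn
    funext i
    change M.map _ (X.π.app _ (act φ g x)) = M.map _ (X.π.app _ (act φ g y))
    rw [← π_map, ← π_map, ← act_map, ← act_map]
    refine ((act_one_aux hφ g ?_).1).symm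
    rw [π_map, π_map]
    exact congrArg _ h

variable (X φ) in
/-- The induced action of `g` on simplices of `M`: `g ⋅ π(x) = π(g ⋅ x)`. -/
def baseActFun (g : G) {n : SimplexCategoryᵒᵖ} (m : M.obj n) : M.obj n :=
  X.π.app n (act φ g (X.η m))

lemma baseActFun_π (hφ : X.Fixes φ) (g : G) {n : SimplexCategoryᵒᵖ} (x : X.E.obj n) :
    X.baseActFun φ g (X.π.app n x) = X.π.app n (act φ g x) :=
  π_act_eq hφ g (X.π_η _)

/-- The automorphism of `M` induced by `g`. -/
def baseHom (hφ : X.Fixes φ) (g : G) : M ⟶ M where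
  app n := ↾(X.baseActFun φ g)
  naturality m n θ := by
    ext y
    change X.baseActFun φ g (M.map θ y) = M.map θ (X.baseActFun φ g y)
    obtain ⟨x, rfl⟩ : ∃ x, X.π.app _ x = y := ⟨_, X.π_η y⟩
    rw [← π_map, baseActFun_π hφ, baseActFun_π hφ, act_map, π_map]

lemma baseHom_π (hφ : X.Fixes φ) (g : G) {n : SimplexCategoryᵒᵖ} (x : X.E.obj n) :
    (baseHom hφ g).app n (X.π.app n x) = X.π.app n (act φ g x) :=
  baseActFun_π hφ g x

lemma baseHom_one (hφ : X.Fixes φ) : baseHom hφ 1 = 𝟙 M := by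
  ext n y
  obtain ⟨x, rfl⟩ : ∃ x, X.π.app _ x = y := ⟨_, X.π_η y⟩
  exact (baseHom_π hφ 1 x).trans (by rw [act_one]; rfl)

lemma baseHom_mul (hφ : X.Fixes φ) (g h : G) :
    baseHom hφ (g * h) = baseHom hφ h ≫ baseHom hφ g := by
  ext n y
  obtain ⟨x, rfl⟩ : ∃ x, X.π.app _ x = y := ⟨_, X.π_η y⟩
  refine (baseHom_π hφ (g * h) x).trans ?_
  change _ = (baseHom hφ g).app n ((baseHom hφ h).app n (X.π.app n x))
  rw [baseHom_π, baseHom_π, act_mul]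

/-- The action of `G` on `M` for which `π : E → M` is equivariant. -/
def baseAction (hφ : X.Fixes φ) : G →* Aut M where
  toFun g :=
    { hom := baseHom hφ g
      inv := baseHom hφ g⁻¹
      hom_inv_id := by rw [← baseHom_mul, inv_mul_cancel, baseHom_one]
      inv_hom_id := by rw [← baseHom_mul, mul_inv_cancel, baseHom_one] }
  map_one' := Iso.ext (baseHom_one hφ)
  map_mul' g h := Iso.ext (baseHom_mul hφ g h)

theorem π_act (hφ : X.Fixes φ) (g : G) {n : SimplexCategoryᵒᵖ} (x : X.E.obj n) :
    X.π.app n (act φ g x) = act (baseAction hφ) g (X.π.app n x) :=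
  (baseHom_π hφ g x).symm

/-- The function `Φ : G × M_1 → A`, `g ⋅ η(g⁻¹ ⋅ x) = (Φ_g(x), x)`. -/
def Phi (hφ : X.Fixes φ) (g : G) (x : M _⦋1⦌) : A :=
  X.coord (act φ g (X.η (act (baseAction hφ) g⁻¹ x)))

lemma coord_act (hφ : X.Fixes φ) (g : G) (x : X.E _⦋1⦌) :
    X.coord (act φ g x) = X.coord x + Phi hφ g (act (baseAction hφ) g (X.π.app _ x)) := by
  have h := (act_one_aux hφ g (x := X.η (X.π.app _ x)) (y := x) (X.π_η _)).2
  rw [h, coord_η, sub_zero, Phi, act_inv_act]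

end CentralExtension

/-! ### The class of the Borel construction -/

/-- `x ⋅ y = z` in a partial monoid: there is a simplex `(x, y)` with product `z`. -/
def IsProd (P : SSet.{u}) (x y z : P _⦋1⦌) : Prop :=
  ∃ w : P _⦋2⦌, P.δ 2 w = x ∧ P.δ 0 w = y ∧ P.δ 1 w = z

namespace CentralExtension

variable {A : Type u} [AddCommGroup A] {M : SSet.{u}} [IsPartialGroup M]
  {X : CentralExtension A M} {G : Type u} [Group G] {φ : G →* Aut X.E}

/-- The pseudo-section `η_G : M // G → E // G` on `1`-simplices, `[(1, g), x] ↦ [(1, g), η(x)]`. -/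
def etaG (hφ : X.Fixes φ) : (borel (baseAction hφ)) _⦋1⦌ → (borel φ) _⦋1⦌ :=
  Quotient.lift (fun a => BorelSimplex.mk φ (p := ⦋1⦌) (q := ⦋1⦌) a.1
      (act φ (a.1 0) (X.η (act (baseAction hφ) (a.1 0)⁻¹ a.2)))) (by
    rintro ⟨a, x⟩ ⟨b, y⟩ ⟨g, rfl, rfl⟩
    refine BorelSimplex.mk_eq.2 ⟨g, rfl, ?_⟩
    simp only [mul_inv_rev, act_mul, act_inv_act])

/-- The inclusion `NA → E → E // G`. -/
def borelFiber (φ : G →* Aut X.E) : nerveGroup A ⟶ borel φ := X.i ≫ borelIncl φ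

/-- The element `a ∈ A` satisfies `a = η_G(x) ⋅ η_G(y) ⋅ η_G(x ⋅ y)⁻¹` in `E // G`, for the simplex
`τ = (x, y)` of `M // G`; that is, `η_G(x) ⋅ η_G(y) = a ⋅ η_G(x ⋅ y)`. -/
def IsBetaG (hφ : X.Fixes φ) (τ : (borel (baseAction hφ)) _⦋2⦌) (a : A) : Prop :=
  ∃ z : (borel φ) _⦋1⦌,
    IsProd (borel φ) (etaG hφ ((borel (baseAction hφ)).δ 2 τ))
      (etaG hφ ((borel (baseAction hφ)).δ 0 τ)) z ∧
    IsProd (borel φ) ((borelFiber φ).app _ (nerveEdge a))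
      (etaG hφ ((borel (baseAction hφ)).δ 1 τ)) z

lemma borel_rep {Y : SSet.{u}} (ρ : G →* Aut Y) {n : ℕ} (x : (borel ρ) _⦋n⦌) (i : Fin (n + 1))
    (g : G) : ∃ (h : Fin (n + 1) → G) (y : Y _⦋n⦌), h i = g ∧
      x = BorelSimplex.mk ρ (p := ⦋n⦌) (q := ⦋n⦌) h y := by
  induction x using Quotient.inductionOn with | _ a =>
  refine ⟨fun j => (g * (a.1 i)⁻¹) * a.1 j, act ρ (g * (a.1 i)⁻¹) a.2, by simp, ?_⟩
  exact (BorelSimplex.mk_smul ρ (p := ⦋n⦌) (q := ⦋n⦌) _ a.1 a.2).symm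

lemma borel_inj {Y : SSet.{u}} {ρ : G →* Aut Y} {n : ℕ} {h h' : Fin (n + 1) → G} {y y' : Y _⦋n⦌}
    (i : Fin (n + 1)) (hi : h i = h' i)
    (e : BorelSimplex.mk ρ (p := ⦋n⦌) (q := ⦋n⦌) h y = BorelSimplex.mk ρ h' y') :
    h = h' ∧ y = y' := by
  obtain ⟨g, h1, h2⟩ := BorelSimplex.mk_eq.1 e
  have : g * h i = h' i := congrFun h1 i
  obtain rfl : g = 1 := by rwa [← hi, mul_eq_right] at this
  exact ⟨by rw [← h1]; simp, by rw [← h2, act_one]⟩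

/-- Products in `E // G` are unique. -/
lemma isProd_unique {x y z z' : (borel φ) _⦋1⦌} (h : IsProd (borel φ) x y z)
    (h' : IsProd (borel φ) x y z') : z = z' := by
  obtain ⟨w, rfl, rfl, rfl⟩ := h
  obtain ⟨w', h₂, h₀, rfl⟩ := h'
  obtain ⟨h, v, hh, rfl⟩ := borel_rep φ w 0 1
  obtain ⟨h', v', hh', rfl⟩ := borel_rep φ w' 0 1
  rw [borel_δ, borel_δ] at h₂ h₀
  obtain ⟨e₁, e₂⟩ := borel_inj (n := 1) 0 (by exact hh'.trans hh.symm) h₂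
  have e3 : h' 1 = h 1 := congrFun e₁ 1
  obtain ⟨e₄, e₅⟩ := borel_inj (n := 1) 0 (by exact e3) h₀
  have e6 : h' 2 = h 2 := congrFun e₄ 1
  have hhh : h' = h := by
    funext i
    fin_cases i
    · exact hh'.trans hh.symm
    · exact e3
    · exact e6
  have hv : v' = v := by
    refine X.ext_two (eq_of_two ?_ ?_) (by rw [e₂]) (by rw [e₅])
    · rw [← π_δ, ← π_δ, e₂]
    · rw [← π_δ, ← π_δ, e₅]
  rw [hhh, hv]

lemma isProd_fiber {a : A} {h : Fin 2 → G} {x : X.E _⦋1⦌} {z : (borel φ) _⦋1⦌}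
    (hφ : X.Fixes φ) : IsProd (borel φ) ((borelFiber φ).app _ (nerveEdge a))
      (BorelSimplex.mk φ (p := ⦋1⦌) (q := ⦋1⦌) h x) z ↔
    z = BorelSimplex.mk φ (p := ⦋1⦌) (q := ⦋1⦌) h
      (X.simplex (n := op ⦋1⦌) (fun _ => a + X.coord x) (X.π.app _ x)) := by
  have ex : IsProd (borel φ) ((borelFiber φ).app _ (nerveEdge a))
      (BorelSimplex.mk φ (p := ⦋1⦌) (q := ⦋1⦌) h x) (BorelSimplex.mk φ (p := ⦋1⦌) (q := ⦋1⦌) h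
      (X.simplex (n := op ⦋1⦌) (fun _ => a + X.coord x) (X.π.app _ x))) := by
    obtain ⟨w, hw, h₂, h₀⟩ := X.exists_two a (X.coord x) (M.σ 0 (X.π.app _ x))
    refine ⟨BorelSimplex.mk φ (p := ⦋2⦌) (q := ⦋2⦌) ![h 0, h 0, h 1] w, ?_, ?_, ?_⟩
    · rw [borel_δ]
      have e : X.E.δ 2 w = X.i.app _ (nerveEdge a) := by
        rw [X.eq_i (x := X.E.δ 2 w) (by rw [π_δ, hw, δ_two_σ_zero]), h₂]
      refine BorelSimplex.mk_eq.2 ⟨(h 0)⁻¹, ?_, ?_⟩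
      · funext i
        fin_cases i <;> exact inv_mul_cancel _
      · rw [e]
        exact act_i hφ _ _
    · rw [borel_δ]
      have e : X.E.δ 0 w = x := X.ext_one (by rw [π_δ, hw, δ_zero_σ_zero]) h₀
      rw [e]
      congr 1
      funext i
      fin_cases i <;> rfl
    · rw [borel_δ]
      have e : X.E.δ 1 w = X.simplex (n := op ⦋1⦌) (fun _ => a + X.coord x) (X.π.app _ x) := by
        refine X.ext_one (by rw [π_δ, hw, δ_one_σ_zero, π_simplex]) ?_
        rw [coord_mul, h₂, h₀, hw, X.isTwisting.degen_zero, add_zero, coord_simplex]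
      rw [e]
      congr 1
      funext i
      fin_cases i <;> rfl
  constructor
  · intro H
    exact isProd_unique H ex
  · rintro rfl
    exact ex

/-- The value of `β_G` in coordinates. -/
lemma isBetaG_iff (hφ : X.Fixes φ) (h : Fin 3 → G) (h0 : h 0 = 1) (σ : M _⦋2⦌) (a : A) :
    IsBetaG hφ (BorelSimplex.mk (baseAction hφ) (p := ⦋2⦌) (q := ⦋2⦌) h σ) a ↔
      a = Phi hφ (h 1) (M.δ 0 σ) + X.β σ := by
  have hη : ∀ (k : Fin 2 → G) (x : M _⦋1⦌), etaG hφ (BorelSimplex.mk (baseAction hφ)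
      (p := ⦋1⦌) (q := ⦋1⦌) k x) = BorelSimplex.mk φ (p := ⦋1⦌) (q := ⦋1⦌) k
        (act φ (k 0) (X.η (act (baseAction hφ) (k 0)⁻¹ x))) := fun _ _ => rfl
  have hη1 : ∀ x : M _⦋1⦌, act φ (h 0) (X.η (act (baseAction hφ) (h 0)⁻¹ x)) = X.η x := by
    intro x
    rw [h0, inv_one, act_one, act_one]
  obtain ⟨w, hw, h₂, h₀⟩ := X.exists_two 0 (Phi hφ (h 1) (M.δ 0 σ)) σ
  have e₂ : X.E.δ 2 w = X.η (M.δ 2 σ) :=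
    X.ext_one (by rw [π_δ, hw, π_η]) (by rw [h₂, coord_η])
  have e₀ : X.E.δ 0 w = act φ (h 1) (X.η (act (baseAction hφ) (h 1)⁻¹ (M.δ 0 σ))) :=
    X.ext_one (by rw [π_δ, hw, π_act hφ, π_η, act_act_inv]) (by rw [h₀]; rfl)
  have hprod : IsProd (borel φ)
      (etaG hφ ((borel (baseAction hφ)).δ 2 (BorelSimplex.mk _ (p := ⦋2⦌) (q := ⦋2⦌) h σ)))
      (etaG hφ ((borel (baseAction hφ)).δ 0 (BorelSimplex.mk _ (p := ⦋2⦌) (q := ⦋2⦌) h σ)))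
      ((borel φ).δ 1 (BorelSimplex.mk φ (p := ⦋2⦌) (q := ⦋2⦌) h w)) := by
    refine ⟨BorelSimplex.mk φ (p := ⦋2⦌) (q := ⦋2⦌) h w, ?_, ?_, rfl⟩
    · rw [borel_δ, borel_δ, hη, e₂]
      exact congrArg (BorelSimplex.mk φ _) (hη1 _).symm
    · rw [borel_δ, borel_δ, hη, e₀]
      rfl
  have c₁ : X.coord (X.E.δ 1 w) = Phi hφ (h 1) (M.δ 0 σ) + X.β σ := by
    rw [coord_mul, h₂, h₀, hw, zero_add]
  have hd1 : etaG hφ ((borel (baseAction hφ)).δ 1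
      (BorelSimplex.mk _ (p := ⦋2⦌) (q := ⦋2⦌) h σ)) = BorelSimplex.mk φ (p := ⦋1⦌) (q := ⦋1⦌)
        (fun j => h ((1 : Fin 3).succAbove j)) (X.η (M.δ 1 σ)) := by
    rw [borel_δ, hη]
    exact congrArg (BorelSimplex.mk φ _) (hη1 _)
  have key : IsBetaG hφ (BorelSimplex.mk (baseAction hφ) (p := ⦋2⦌) (q := ⦋2⦌) h σ) a ↔
      IsProd (borel φ) ((borelFiber φ).app _ (nerveEdge a)) (BorelSimplex.mk φ (p := ⦋1⦌)
        (q := ⦋1⦌) (fun j => h ((1 : Fin 3).succAbove j)) (X.η (M.δ 1 σ)))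
        ((borel φ).δ 1 (BorelSimplex.mk φ (p := ⦋2⦌) (q := ⦋2⦌) h w)) := by
    unfold IsBetaG
    rw [hd1]
    constructor
    · rintro ⟨z, hz, hz'⟩
      rwa [isProd_unique hprod hz]
    · intro H
      exact ⟨_, hprod, H⟩
  rw [key, isProd_fiber hφ, borel_δ, π_η, coord_η, add_zero]
  constructor
  · intro H
    have := (borel_inj (n := 1) 0 rfl H).2
    rw [← c₁, this, coord_simplex]
  · intro H
    congr 1
    refine X.ext_one (by rw [π_δ, hw, π_simplex]) ?_
    rw [c₁, coord_simplex, H]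

theorem existsUnique_betaG (hφ : X.Fixes φ) (τ : (borel (baseAction hφ)) _⦋2⦌) :
    ∃! a : A, IsBetaG hφ τ a := by
  obtain ⟨h, σ, h0, rfl⟩ := borel_rep _ τ 0 1
  simp only [isBetaG_iff hφ h h0]
  exact existsUnique_eq

/-- The cocycle `β_G : (M // G)_2 → A`, `β_G(x, y) = η_G(x) ⋅ η_G(y) ⋅ η_G(x ⋅ y)⁻¹`. -/
noncomputable def betaG (hφ : X.Fixes φ) (τ : (borel (baseAction hφ)) _⦋2⦌) : A :=
  (existsUnique_betaG hφ τ).choose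

theorem betaG_spec (hφ : X.Fixes φ) (τ : (borel (baseAction hφ)) _⦋2⦌) :
    IsBetaG hφ τ (betaG hφ τ) := (existsUnique_betaG hφ τ).choose_spec.1

lemma betaG_mk (hφ : X.Fixes φ) (h : Fin 3 → G) (h0 : h 0 = 1) (σ : M _⦋2⦌) :
    betaG hφ (BorelSimplex.mk (baseAction hφ) (p := ⦋2⦌) (q := ⦋2⦌) h σ) =
      Phi hφ (h 1) (M.δ 0 σ) + X.β σ :=
  (isBetaG_iff hφ h h0 σ _).1 (betaG_spec hφ _)

/-- `d^h Φ = 0`. -/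
lemma Phi_mul (hφ : X.Fixes φ) (g h : G) (x : M _⦋1⦌) :
    Phi hφ (g * h) x = Phi hφ g x + Phi hφ h (act (baseAction hφ) g⁻¹ x) := by
  have e : act (baseAction hφ) h (act (baseAction hφ) (g * h)⁻¹ x) =
      act (baseAction hφ) g⁻¹ x := by
    rw [← act_mul]
    congr 1
    group
  rw [Phi, act_mul φ, coord_act hφ, coord_act hφ, coord_η, π_act hφ, π_η, e, act_act_inv,
    zero_add, add_comm]

/-- `d^v Φ = d^h β`. -/
lemma Phi_face (hφ : X.Fixes φ) (g : G) (y : M _⦋2⦌) :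
    Phi hφ g (M.δ 0 y) - Phi hφ g (M.δ 1 y) + Phi hφ g (M.δ 2 y) =
      X.β (act (baseAction hφ) g⁻¹ y) - X.β y := by
  obtain ⟨w, hw, -, -⟩ := X.exists_two 0 0 (act (baseAction hφ) g⁻¹ y)
  have hg : X.π.app _ (act φ g w) = y := by rw [π_act hφ, hw, act_act_inv]
  have h1 := X.coord_mul (act φ g w)
  have h2 := X.coord_mul w
  have e : ∀ i : Fin 3, X.coord (X.E.δ i (act φ g w)) =
      X.coord (X.E.δ i w) + Phi hφ g (M.δ i y) := by
    intro i
    rw [← act_δ, coord_act hφ, π_δ, hw, act_δ, act_act_inv]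
  rw [e, e, e, hg, h2, hw] at h1
  rw [← sub_eq_zero] at h1 ⊢
  rw [← neg_eq_zero, ← h1]
  abel

theorem betaG_mem_ker (hφ : X.Fixes φ) :
    betaG hφ ∈ (cobd (borel (baseAction hφ)) A 2).ker := by
  rw [AddMonoidHom.mem_ker]
  funext τ
  obtain ⟨h, σ, h0, rfl⟩ := borel_rep _ τ 0 1
  change ∑ i : Fin 4, (-1 : ℤ) ^ (i : ℕ) • betaG hφ ((borel (baseAction hφ)).δ i _) = 0
  rw [Fin.sum_univ_four]
  simp only [borel_δ]
  have d0 : betaG hφ (BorelSimplex.mk (baseAction hφ) (p := ⦋2⦌) (q := ⦋2⦌)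
      (fun j => h ((0 : Fin 4).succAbove j)) (M.δ 0 σ)) =
      Phi hφ ((h 1)⁻¹ * h 2) (act (baseAction hφ) (h 1)⁻¹ (M.δ 0 (M.δ 0 σ))) +
        X.β (act (baseAction hφ) (h 1)⁻¹ (M.δ 0 σ)) := by
    rw [← BorelSimplex.mk_smul (baseAction hφ) (h 1)⁻¹, betaG_mk, act_δ (baseAction hφ) (h 1)⁻¹ 0 (M.δ 0 σ)]
    · rfl
    · exact inv_mul_cancel _
  have d1 : betaG hφ (BorelSimplex.mk (baseAction hφ) (p := ⦋2⦌) (q := ⦋2⦌)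
      (fun j => h ((1 : Fin 4).succAbove j)) (M.δ 1 σ)) =
      Phi hφ (h 2) (M.δ 0 (M.δ 1 σ)) + X.β (M.δ 1 σ) := betaG_mk hφ _ h0 _
  have d2 : betaG hφ (BorelSimplex.mk (baseAction hφ) (p := ⦋2⦌) (q := ⦋2⦌)
      (fun j => h ((2 : Fin 4).succAbove j)) (M.δ 2 σ)) =
      Phi hφ (h 1) (M.δ 0 (M.δ 2 σ)) + X.β (M.δ 2 σ) := betaG_mk hφ _ h0 _
  have d3 : betaG hφ (BorelSimplex.mk (baseAction hφ) (p := ⦋2⦌) (q := ⦋2⦌)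
      (fun j => h ((3 : Fin 4).succAbove j)) (M.δ 3 σ)) =
      Phi hφ (h 1) (M.δ 0 (M.δ 3 σ)) + X.β (M.δ 3 σ) := betaG_mk hφ _ h0 _
  have s1 : M.δ 0 (M.δ 1 σ) = M.δ 0 (M.δ 0 σ) :=
    types_congr_hom (SimplicialObject.δ_comp_δ M (i := (0 : Fin 3)) (j := 0) le_rfl) σ
  have s2 : M.δ 0 (M.δ 2 σ) = M.δ 1 (M.δ 0 σ) :=
    types_congr_hom (SimplicialObject.δ_comp_δ M (i := (0 : Fin 3)) (j := 1) (by decide)) σ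
  have s3 : M.δ 0 (M.δ 3 σ) = M.δ 2 (M.δ 0 σ) :=
    types_congr_hom (SimplicialObject.δ_comp_δ M (i := (0 : Fin 3)) (j := 2) (by decide)) σ
  have hm := Phi_mul hφ (h 1) ((h 1)⁻¹ * h 2) (M.δ 0 (M.δ 0 σ))
  rw [mul_inv_cancel_left] at hm
  have hf := Phi_face hφ (h 1) (M.δ 0 σ)
  have hc := X.isTwisting.cocycle σ
  rw [d0, d1, d2, d3, s1, s2, s3, hm]
  rw [← sub_eq_zero] at hf hc
  have : (0 : A) = -(Phi hφ (h 1) (M.δ 0 (M.δ 0 σ)) - Phi hφ (h 1) (M.δ 1 (M.δ 0 σ)) +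
    Phi hφ (h 1) (M.δ 2 (M.δ 0 σ)) - (X.β (act (baseAction hφ) (h 1)⁻¹ (M.δ 0 σ)) -
      X.β (M.δ 0 σ))) + (X.β (M.δ 0 σ) + X.β (M.δ 2 σ) - (X.β (M.δ 3 σ) + X.β (M.δ 1 σ))) := by
    rw [hf, hc]; simp
  rw [this]
  simp
  abel

/-- The class `[β_G] ∈ H²(M // G, A)`. -/
noncomputable def betaGClass (hφ : X.Fixes φ) : H2 (borel (baseAction hφ)) A :=
  H2.mk _ _ ⟨betaG hφ, betaG_mem_ker hφ⟩

end CentralExtension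

end PartialGroupExt

namespace PartialGroupExt

/-! All three conditions amount to one pair of equations for a function `s` on `M_1`: s(d₀y) -
s(d₁y) + s(d₂y) = β(y) for 2-simplices y, and s(g⁻¹x) - s(x) = Φ_g(x). For condition 2 this is the
evaluation of cochains on representatives with h₀ = 1 (`dv_cochainZero_eq_iff`,
`dh_cochainZero_eq_iff`).

For the class (`betaGClass_eq_zero_iff_exists`), β_G takes the value Φ_g(d₀y) + β(y) on [(1,g,k),
y]. A solution s extends to the 1-cochain [(1,g), x] ↦ s(x), which bounds β_G. Conversely, a
bounding cochain t restricts to s(x) = t[(1,1), x]. The equation for β is the restriction of the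
bounding equation to M. The equation for Φ comes from the square in M // G expressing that x
followed by g equals g followed by g⁻¹x. Its two triangles share the diagonal [(1,g), x], and since
M has a single vertex their two g-edges are the same 1-simplex [(1,g), 1]. Subtracting therefore
leaves only values of s, even if t is not normalized.

For sections (`exists_equivariant_section_iff`), λ corresponds to s through λ(x) = (-s(x), x) on
1-simplices. The twisted multiplication rule turns compatibility with 2-simplices into the first
equation, and the formula for g ⋅ (a, x) turns equivariance into the second. Edges suffice because a
simplex of E is determined by its image in M and its spine coordinates. -/

/-! ### Faces of degenerate 2-simplices and coboundaries of 1-cochains. -/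

lemma δ_zero_σ_one {M : SSet.{u}} [IsPartialMonoid M] (x : M _⦋1⦌) : M.δ 0 (M.σ 1 x) = one M := by
  rw [← σ_zero_vertex (M.δ 0 x)]
  exact types_congr_hom (SimplicialObject.δ_comp_σ_of_le M
    (i := (0 : Fin 2)) (j := (0 : Fin 1)) (by decide)) x

lemma δ_one_σ_one {M : SSet.{u}} (x : M _⦋1⦌) : M.δ 1 (M.σ 1 x) = x :=
  types_congr_hom (SimplicialObject.δ_comp_σ_self M (i := (1 : Fin 2))) x

lemma δ_two_σ_one {M : SSet.{u}} (x : M _⦋1⦌) : M.δ 2 (M.σ 1 x) = x :=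
  types_congr_hom (SimplicialObject.δ_comp_σ_succ M (i := (1 : Fin 2))) x

lemma cobd_one_apply (Y : SSet.{u}) (A : Type u) [AddCommGroup A] (t : Y _⦋1⦌ → A)
    (y : Y _⦋2⦌) : cobd Y A 1 t y = t (Y.δ 0 y) - t (Y.δ 1 y) + t (Y.δ 2 y) := by
  change ∑ i : Fin 3, (-1 : ℤ) ^ (i : ℕ) • t (Y.δ i y) = _
  rw [Fin.sum_univ_three]
  simp [sub_eq_add_neg]

/-! ### Cochain equations on the bisimplicial set in coordinates. -/

section BorelCochains

variable {A G : Type u} [AddCommGroup A] [Group G] {Y : SSet.{u}} (ρ : G →* Aut Y)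

/-- The equation `d^v s = b` in coordinates. -/
lemma dv_cochainZero_eq_iff (s : Y _⦋1⦌ → A) (b : Y _⦋2⦌ → A) :
    dv ρ A 0 1 (cochainZero ρ 1 s) = cochainZero ρ 2 b ↔
      ∀ y : Y _⦋2⦌, s (Y.δ 0 y) - s (Y.δ 1 y) + s (Y.δ 2 y) = b y := by
  -- The translate by (h 0)⁻¹ appears because [(h₀), y] = [(1), h₀⁻¹y] and cochains are evaluated on
  -- the representative with leading entry 1.
  have key : ∀ (h : Fin 1 → G) (y : Y _⦋2⦌),
      dv ρ A 0 1 (cochainZero ρ 1 s) (BorelSimplex.mk ρ (p := ⦋0⦌) (q := ⦋2⦌) h y) =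
        s (Y.δ 0 (act ρ (h 0)⁻¹ y)) - s (Y.δ 1 (act ρ (h 0)⁻¹ y)) +
          s (Y.δ 2 (act ρ (h 0)⁻¹ y)) := by
    intro h y
    change ∑ i : Fin 3, (-1 : ℤ) ^ (i : ℕ) • s (act ρ (h 0)⁻¹ (Y.δ i y)) = _
    rw [Fin.sum_univ_three]
    simp [sub_eq_add_neg, CentralExtension.act_δ]
  constructor
  · intro H y
    have := congrFun H (BorelSimplex.mk ρ (p := ⦋0⦌) (q := ⦋2⦌) (fun _ => 1) y)
    rw [key, inv_one, act_one] at this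
    rw [this]
    change b (act ρ 1⁻¹ y) = b y
    rw [inv_one, act_one]
  · intro H
    funext z
    induction z using Quotient.inductionOn with | _ a =>
    exact (key a.1 a.2).trans (H _)

/-- The equation `d^h s = f` in coordinates. -/
lemma dh_cochainZero_eq_iff (q : ℕ) (s : Y _⦋q⦌ → A) (f : G → Y _⦋q⦌ → A) :
    dh ρ A 0 q (cochainZero ρ q s) = cochainOne ρ q f ↔
      ∀ (g : G) (x : Y _⦋q⦌), s (act ρ g⁻¹ x) - s x = f g x := by
  -- The face dropping h₀ leaves (h₁) and contributes with sign +; the face dropping h₁ leaves (h₀)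
  -- and contributes with sign -.
  have key : ∀ (h : Fin 2 → G) (x : Y _⦋q⦌),
      dh ρ A 0 q (cochainZero ρ q s) (BorelSimplex.mk ρ (p := ⦋1⦌) (q := ⦋q⦌) h x) =
        s (act ρ (h 1)⁻¹ x) - s (act ρ (h 0)⁻¹ x) := by
    intro h x
    change ∑ i : Fin 2, (-1 : ℤ) ^ (i : ℕ) •
      s (act ρ (h (i.succAbove 0))⁻¹ (Y.map (𝟙 ⦋q⦌ : ⦋q⦌ ⟶ ⦋q⦌).op x)) = _
    rw [Fin.sum_univ_two, op_id, Functor.map_id_apply]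
    simp [sub_eq_add_neg]
  constructor
  · intro H g x
    have := congrFun H (BorelSimplex.mk ρ (p := ⦋1⦌) (q := ⦋q⦌) ![1, g] x)
    rw [key] at this
    change s (act ρ g⁻¹ x) - s (act ρ 1⁻¹ x) = f (1⁻¹ * g) (act ρ 1⁻¹ x) at this
    rwa [inv_one, act_one, one_mul] at this
  · intro H
    funext z
    induction z using Quotient.inductionOn with | _ a =>
    refine (key a.1 a.2).trans ?_
    change _ = f ((a.1 0)⁻¹ * a.1 1) (act ρ (a.1 0)⁻¹ a.2)
    -- `H` is applied to the group element h₀⁻¹h₁ at the point h₀⁻¹x; what remains is (h₀⁻¹h₁)⁻¹h₀⁻¹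
    -- = h₁⁻¹.
    rw [← H, ← act_mul]
    congr 3
    group

end BorelCochains

/-! ### Vanishing of the class of β_G. -/

namespace CentralExtension

variable {A G : Type u} [AddCommGroup A] [Group G] {M : SSet.{u}} [IsPartialGroup M]
  {X : CentralExtension A M} {φ : G →* Aut X.E}

lemma Phi_one (hφ : X.Fixes φ) (x : M _⦋1⦌) : Phi hφ 1 x = 0 := by
  rw [Phi, act_one, coord_η]

lemma betaGClass_eq_zero_iff (hφ : X.Fixes φ) :
    betaGClass hφ = 0 ↔ ∃ t, cobd (borel (baseAction hφ)) A 1 t = betaG hφ := by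
  unfold betaGClass H2.mk
  rw [QuotientAddGroup.eq_zero_iff, AddSubgroup.mem_addSubgroupOf]
  exact Iff.rfl

/-- A one-cochain on `M // G` bounding `β_G`, in coordinates. -/
lemma cobd_eq_betaG_iff (hφ : X.Fixes φ) (t : (borel (baseAction hφ)) _⦋1⦌ → A) :
    cobd (borel (baseAction hφ)) A 1 t = betaG hφ ↔
      ∀ (g k : G) (y : M _⦋2⦌),
        t (BorelSimplex.mk _ (p := ⦋1⦌) (q := ⦋1⦌) ![g, k] (M.δ 0 y)) -
          t (BorelSimplex.mk _ (p := ⦋1⦌) (q := ⦋1⦌) ![1, k] (M.δ 1 y)) +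
          t (BorelSimplex.mk _ (p := ⦋1⦌) (q := ⦋1⦌) ![1, g] (M.δ 2 y)) =
        Phi hφ g (M.δ 0 y) + X.β y := by
  have key : ∀ (g k : G) (y : M _⦋2⦌),
      (cobd (borel (baseAction hφ)) A 1 t
        (BorelSimplex.mk _ (p := ⦋2⦌) (q := ⦋2⦌) ![1, g, k] y) =
        t (BorelSimplex.mk _ (p := ⦋1⦌) (q := ⦋1⦌) ![g, k] (M.δ 0 y)) -
          t (BorelSimplex.mk _ (p := ⦋1⦌) (q := ⦋1⦌) ![1, k] (M.δ 1 y)) +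
          t (BorelSimplex.mk _ (p := ⦋1⦌) (q := ⦋1⦌) ![1, g] (M.δ 2 y))) := by
    intro g k y
    have e₀ : (fun j => ![1, g, k] ((0 : Fin 3).succAbove j)) = ![g, k] := by
      funext j; fin_cases j <;> rfl
    have e₁ : (fun j => ![1, g, k] ((1 : Fin 3).succAbove j)) = ![1, k] := by
      funext j; fin_cases j <;> rfl
    have e₂ : (fun j => ![1, g, k] ((2 : Fin 3).succAbove j)) = ![1, g] := by
      funext j; fin_cases j <;> rfl
    refine (cobd_one_apply _ A t _).trans ?_
    rw [borel_δ, borel_δ, borel_δ, e₀, e₁, e₂]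
  constructor
  · intro H g k y
    rw [← key, H, betaG_mk hφ _ rfl]
    rfl
  · intro H
    funext τ
    -- Every 2-simplex of the Borel construction has a representative with h₀ = 1, so the vectors
    -- `![1, g, k]` exhaust all cases.
    obtain ⟨h, y, h0, rfl⟩ := borel_rep _ τ 0 1
    obtain ⟨g, k, rfl⟩ : ∃ g k, h = ![1, g, k] := by
      refine ⟨h 1, h 2, ?_⟩
      funext i
      fin_cases i
      · exact h0
      · rfl
      · rfl
    exact ((key g k y).trans (H g k y)).trans (betaG_mk hφ ![1, g, k] rfl y).symm

/-- An arbitrary bounding 1-cochain on M // G can be replaced by one coming from M alone. Its values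
on the edges [(1,g), 1] do not matter: they cancel between the two triangles of the square with
sides x and g. -/
lemma betaGClass_eq_zero_iff_exists (hφ : X.Fixes φ) :
    betaGClass hφ = 0 ↔ ∃ s : M _⦋1⦌ → A,
      (∀ y : M _⦋2⦌, s (M.δ 0 y) - s (M.δ 1 y) + s (M.δ 2 y) = X.β y) ∧
      ∀ (g : G) (x : M _⦋1⦌), s (act (baseAction hφ) g⁻¹ x) - s x = Phi hφ g x := by
  rw [betaGClass_eq_zero_iff]
  constructor
  · rintro ⟨t, ht⟩
    rw [cobd_eq_betaG_iff] at ht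
    refine ⟨fun x => t (BorelSimplex.mk _ (p := ⦋1⦌) (q := ⦋1⦌) ![1, 1] x), fun y => ?_,
      fun g x => ?_⟩
    -- With g = k = 1 all edges lie in the image of M, and the term in Φ vanishes.
    · have := ht 1 1 y
      rwa [Phi_one, zero_add] at this
    -- These are the two triangles of the square: [(1,g,g), s₀x] is g followed by g⁻¹x, and
    -- [(1,1,g), s₁x] is x followed by g. Both have product [(1,g), x], and β vanishes on both by
    -- normalization.
    · have left := ht g g (M.σ 0 x)
      have right := ht 1 g (M.σ 1 x)
      rw [δ_zero_σ_zero, δ_one_σ_zero, δ_two_σ_zero, X.isTwisting.degen_zero, add_zero] at left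
      rw [δ_zero_σ_one, δ_one_σ_one, δ_two_σ_one, X.isTwisting.degen_one, add_zero,
        Phi_one] at right
      have e : BorelSimplex.mk (baseAction hφ) (p := ⦋1⦌) (q := ⦋1⦌) ![1, 1]
          (act (baseAction hφ) g⁻¹ x) =
          BorelSimplex.mk (baseAction hφ) (p := ⦋1⦌) (q := ⦋1⦌) ![g, g] x := by
        refine BorelSimplex.mk_eq.2 ⟨g, ?_, act_act_inv _ _ _⟩
        funext i
        fin_cases i <;> exact mul_one g
      beta_reduce
      -- The inserted 0 is replaced by the left side of `right`; the values of t on [(1,g), x] and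
      -- [(1,g), 1] then cancel.
      rw [e, ← left, ← sub_zero (_ - _ + _), ← right]
      abel
  · rintro ⟨s, hβ, hΦ⟩
    -- On [(g,k), x] this cochain is s(g⁻¹x). Only the zeroth face of [(1,g,k), y] has leading entry
    -- g; there s(g⁻¹d₀y) = s(d₀y) + Φ_g(d₀y) supplies the Φ-term of β_G.
    refine ⟨cochainOne _ 1 fun _ x => s x, (cobd_eq_betaG_iff hφ _).2 fun g k y => ?_⟩
    change s (act (baseAction hφ) g⁻¹ (M.δ 0 y)) - s (act (baseAction hφ) 1⁻¹ (M.δ 1 y)) +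
      s (act (baseAction hφ) 1⁻¹ (M.δ 2 y)) = _
    rw [inv_one, act_one, act_one, ← hΦ, ← hβ]
    abel

/-! ### Sections of the extension and their equivariance. -/

/-- The section `x ↦ (-s(x), x)` of a central extension determined by a one-cochain `s` with
coboundary `β`. -/
def sectionOfCochain (s : M _⦋1⦌ → A)
    (hs : ∀ y : M _⦋2⦌, s (M.δ 0 y) - s (M.δ 1 y) + s (M.δ 2 y) = X.β y) : M ⟶ X.E :=
  { app := fun n => ↾fun x =>
      ({ base := x
         -- Labelling every edge, not only the spine, makes naturality immediate; multiplicativity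
         -- on a triangle is then `hs` for that triangle.
         label := fun e => -s (M.map e.op x)
         label_mul := fun t => by
          rw [← hs, op_comp, op_comp, op_comp, Functor.map_comp_apply, Functor.map_comp_apply,
            Functor.map_comp_apply]
          change -s (M.δ 1 (M.map t.op x)) =
            -s (M.δ 2 (M.map t.op x)) + -s (M.δ 0 (M.map t.op x)) + _
          abel } : TwistedSimplex X.β n.unop)
    naturality := fun m n θ => by
      ext x
      apply TwistedSimplex.ext
      · rfl
      · funext e
        change -s (M.map e.op (M.map θ x)) = -s (M.map (e ≫ θ.unop).op x)
        rw [op_comp, Functor.map_comp_apply]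
        rfl : M ⟶ twistedProduct X.β } ≫ X.iso.inv

lemma sectionOfCochain_comp_π (s : M _⦋1⦌ → A)
    (hs : ∀ y : M _⦋2⦌, s (M.δ 0 y) - s (M.δ 1 y) + s (M.δ 2 y) = X.β y) :
    sectionOfCochain s hs ≫ X.π = 𝟙 M := by
  rw [sectionOfCochain, ← X.iso_comp_proj, Category.assoc, Iso.inv_hom_id_assoc]
  rfl

lemma coord_sectionOfCochain (s : M _⦋1⦌ → A)
    (hs : ∀ y : M _⦋2⦌, s (M.δ 0 y) - s (M.δ 1 y) + s (M.δ 2 y) = X.β y) (x : M _⦋1⦌) :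
    X.coord ((sectionOfCochain s hs).app _ x) = -s x := by
  unfold coord sectionOfCochain
  rw [NatTrans.comp_app, types_comp_apply, hom_inv]
  change -s (M.map (𝟙 ⦋1⦌ : ⦋1⦌ ⟶ ⦋1⦌).op x) = -s x
  rw [op_id, Functor.map_id_apply]

lemma π_section {l : M ⟶ X.E} (hl : l ≫ X.π = 𝟙 M) {n : SimplexCategoryᵒᵖ} (x : M.obj n) :
    X.π.app n (l.app n x) = x :=
  types_congr_hom (congrArg (fun f : M ⟶ M => f.app n) hl) x

/-- A section is equivariant if and only if its coordinates on `1`-simplices are compatible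
with `Φ`. -/
lemma section_equivariant_iff (hφ : X.Fixes φ) {l : M ⟶ X.E} (hl : l ≫ X.π = 𝟙 M) :
    (∀ g : G, (baseAction hφ g).hom ≫ l = l ≫ (φ g).hom) ↔
      ∀ (g : G) (x : M _⦋1⦌), X.coord (l.app _ x) =
        X.coord (l.app _ (act (baseAction hφ) g⁻¹ x)) + Phi hφ g x := by
  have act_coord : ∀ (g : G) (x : M _⦋1⦌), X.coord (act φ g (l.app _ x)) =
      X.coord (l.app _ x) + Phi hφ g (act (baseAction hφ) g x) := by
    intro g x
    rw [coord_act hφ, π_section hl]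
  constructor
  · intro H g x
    have e : l.app _ (act (baseAction hφ) g (act (baseAction hφ) g⁻¹ x)) =
        act φ g (l.app _ (act (baseAction hφ) g⁻¹ x)) :=
      types_congr_hom (congrArg (fun f : M ⟶ X.E => f.app _) (H g)) _
    have := act_coord g (act (baseAction hφ) g⁻¹ x)
    rwa [← e, act_act_inv] at this
  · intro H g
    ext ⟨n⟩ x
    induction n using SimplexCategory.rec with | _ n =>
    change l.app _ (act (baseAction hφ) g x) = act φ g (l.app _ x)
    -- Equality in E is tested on the projection and on spine edges. The projections agree because π
    -- is equivariant and l is a section, which leaves the condition on 1-simplices.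
    apply X.ext_coord
    · rw [π_section hl, π_act hφ, π_section hl]
    · intro i
      -- The hypothesis is used at the translate by g of a spine edge, so that its g⁻¹ cancels.
      rw [← act_map, ← NatTrans.naturality_apply, ← NatTrans.naturality_apply, act_coord,
        ← act_map, H g, act_inv_act]

/-- The correspondence is s = -coord ∘ λ on 1-simplices. The sign is forced: coordinates satisfy
c(d₁y) = c(d₂y) + c(d₀y) + β(y), so the coboundary of c is -β. -/
lemma exists_equivariant_section_iff (hφ : X.Fixes φ) :
    (∃ l : M ⟶ X.E, l ≫ X.π = 𝟙 M ∧
      ∀ g : G, (baseAction hφ g).hom ≫ l = l ≫ (φ g).hom) ↔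
    ∃ s : M _⦋1⦌ → A,
      (∀ y : M _⦋2⦌, s (M.δ 0 y) - s (M.δ 1 y) + s (M.δ 2 y) = X.β y) ∧
      ∀ (g : G) (x : M _⦋1⦌), s (act (baseAction hφ) g⁻¹ x) - s x = Phi hφ g x := by
  constructor
  · rintro ⟨l, hl, H⟩
    rw [section_equivariant_iff hφ hl] at H
    refine ⟨fun x => -X.coord (l.app _ x), fun y => ?_, fun g x => ?_⟩
    · have h := X.coord_mul (l.app _ y)
      have e : ∀ i : Fin 3, X.E.δ i (l.app _ y) = l.app _ (M.δ i y) := fun i =>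
        (NatTrans.naturality_apply l (SimplexCategory.δ i).op y).symm
      rw [e, e, e, π_section hl] at h
      beta_reduce
      rw [h]
      abel
    · beta_reduce
      rw [H g x]
      abel
  · rintro ⟨s, hβ, hΦ⟩
    refine ⟨sectionOfCochain s hβ, sectionOfCochain_comp_π s hβ,
      (section_equivariant_iff hφ (sectionOfCochain_comp_π s hβ)).2 fun g x => ?_⟩
    rw [coord_sectionOfCochain, coord_sectionOfCochain, ← hΦ]
    abel

end CentralExtension

end PartialGroupExt

theorem mainTheorem1 {A G : Type u} [AddCommGroup A] [Group G]
    {M : SSet.{u}} [PartialGroupExt.IsPartialGroup M]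
    (X : PartialGroupExt.CentralExtension A M)
    (φ : G →* Aut X.E) (hφ : X.Fixes φ) :
    List.TFAE
      [PartialGroupExt.CentralExtension.betaGClass hφ = 0,
       ∃ s : M _⦋1⦌ → A,
        PartialGroupExt.dv (PartialGroupExt.CentralExtension.baseAction hφ) A 0 1
            (PartialGroupExt.cochainZero _ 1 s) =
          PartialGroupExt.cochainZero _ 2 X.β ∧
        PartialGroupExt.dh (PartialGroupExt.CentralExtension.baseAction hφ) A 0 1
            (PartialGroupExt.cochainZero _ 1 s) =
          PartialGroupExt.cochainOne _ 1 (PartialGroupExt.CentralExtension.Phi hφ),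
       ∃ l : M ⟶ X.E, l ≫ X.π = 𝟙 M ∧
        ∀ g : G, (PartialGroupExt.CentralExtension.baseAction hφ g).hom ≫ l =
          l ≫ (φ g).hom] := by
  -- The second condition, in coordinates, is the form to which the other two are compared.
  simp only [PartialGroupExt.dv_cochainZero_eq_iff, PartialGroupExt.dh_cochainZero_eq_iff]
  tfae_have 1 ↔ 2 := PartialGroupExt.CentralExtension.betaGClass_eq_zero_iff_exists hφ
  tfae_have 3 ↔ 2 := PartialGroupExt.CentralExtension.exists_equivariant_section_iff hφ
  tfae_finish
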